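/- Let $G=\operatorname{PSL}_2(\mathbb Z)=\operatorname{SL}_2(\mathbb Z)/\{\pm1\}$, generated by the classes $a$ and $b$ of $\begin{pmatrix}0&-1\\1&0\end{pmatrix}$ and $\begin{pmatrix}0&-1\\1&1\end{pmatrix}$, so that $G=\langle a,b\mid a^2=1,\ b^3=1\rangle$. Let $\Gamma$ be the Cayley graph of $G$ with respect to $a,b$, in which the generator $a$ of order two gives double edges; $\Gamma$ is $4$-regular. Let $\mathcal L$ be its normalized Laplacian, that is, the bounded operator on the complex Hilbert space $\ell^2(G)$ given by $$(\mathcal L f)(x)=f(x)-\tfrac12 f(xa)-\tfrac14 f(xb)-\tfrac14 f(xb^{-1}),\qquad x\in G.$$ Put $$\lambda_0=\frac78-\frac12\sqrt{\frac{25}{16}+\sqrt2}=0.01234\ldots,\qquad \lambda_1=\frac78+\frac12\sqrt{\frac{25}{16}-\sqrt2}=1.0675\ldots$$ Then the spectrum of $\mathcal L$ is the closed subset $$\operatorname{Sp}(\mathcal L)=\Big[\lambda_0,\frac74-\lambda_1\Big]\sqcup\Big\{\frac34\Big\}\sqcup\Big[\lambda_1,\frac74-\lambda_0\Big]\sqcup\Big\{\frac74\Big\}$$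 of $\mathbb R$; in particular these four sets are pairwise disjoint. -/

import Mathlib

open scoped MatrixGroups ENNReal

noncomputable section

namespace ModularCayley

/-! ### Weighted graphs and the normalized Laplacian -/

/-- A weighted graph on the vertex set `V`: a non-negative symmetric weight function. -/
structure WeightedGraph (V : Type*) where
  w : V → V → ℝ
  nonneg : ∀ u v, 0 ≤ w u v
  symm : ∀ u v, w u v = w v u

namespace WeightedGraph

variable {V : Type*} (Γ : WeightedGraph V)

/-- The degree of a vertex. -/
def degree (u : V) : ℝ := ∑' v, Γ.w u v

open Classical in
/-- The matrix coefficients of the normalized Laplacian. -/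
def normLaplacianCoeff (u v : V) : ℝ :=
  (if u = v then 1 else 0) - Γ.w u v / √(Γ.degree u * Γ.degree v)

end WeightedGraph

open Classical in
/-- The Cayley graph of `G` with respect to a family `s` of generators: each generator `s i` and
each vertex `x` give one edge joining `x` to `x * s i`, and `w x y` counts the edges joining `x`
and `y`. A generator of order two therefore gives double edges. -/
def cayleyGraph {G ι : Type*} [Group G] [Fintype ι] (s : ι → G) : WeightedGraph G where
  w x y := ∑ i, ((if x * s i = y then 1 else 0) + (if y * s i = x then 1 else 0))
  nonneg x y := Finset.sum_nonneg fun i _ => by positivity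
  symm x y := Finset.sum_congr rfl fun i _ => add_comm _ _

/-! ### The Hilbert space and right translations -/

/-- The complex Hilbert space `ℓ²(G)`. -/
abbrev ell2 (G : Type*) := lp (fun _ : G => ℂ) 2

variable {G : Type*} [Group G]

theorem memlp_translate (g : G) (f : ell2 G) :
    Memℓp (fun x => (f : G → ℂ) (x * g)) 2 := by
  have h := lp.memℓp f
  rw [memℓp_gen_iff (by norm_num)] at h ⊢
  exact (Equiv.summable_iff (Equiv.mulRight g)).2 h

/-- Right translation `(R_g f)(x) = f (x g)` as a bounded operator on `ℓ²(G)`. -/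
def translate (g : G) : ell2 G →L[ℂ] ell2 G :=
  LinearMap.mkContinuous
    { toFun := fun f => ⟨fun x => (f : G → ℂ) (x * g), memlp_translate g f⟩
      map_add' := fun _ _ => rfl
      map_smul' := fun _ _ => rfl } 1 (fun f => by
    rw [one_mul, lp.norm_eq_tsum_rpow (by norm_num), lp.norm_eq_tsum_rpow (by norm_num)]
    apply le_of_eq
    congr 1
    exact (Equiv.mulRight g).tsum_eq (fun x => ‖(f : G → ℂ) x‖ ^ (2 : ℝ≥0∞).toReal))

@[simp] theorem translate_apply (g : G) (f : ell2 G) (x : G) :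
    (translate g f : G → ℂ) x = (f : G → ℂ) (x * g) := rfl

/-! ### The modular group -/

/-- The matrix representing the generator `a`. -/
def aMat : SL(2, ℤ) := ⟨!![0, -1; 1, 0], by simp [Matrix.det_fin_two]⟩

/-- The matrix representing the generator `b`. -/
def bMat : SL(2, ℤ) := ⟨!![0, -1; 1, 1], by simp [Matrix.det_fin_two]⟩

theorem coe_aMat : (aMat : Matrix (Fin 2) (Fin 2) ℤ) = !![0, -1; 1, 0] := rfl

theorem coe_bMat : (bMat : Matrix (Fin 2) (Fin 2) ℤ) = !![0, -1; 1, 1] := rfl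

/-- The generator of order two of `PSL₂(ℤ)`. -/
def a : PSL(2, ℤ) := QuotientGroup.mk aMat

/-- The generator of order three of `PSL₂(ℤ)`. -/
def b : PSL(2, ℤ) := QuotientGroup.mk bMat

/-- The Cayley graph of `PSL₂(ℤ)` with respect to `a, b`. -/
def modularGraph : WeightedGraph PSL(2, ℤ) := cayleyGraph ![a, b]

/-- The normalized Laplacian of `modularGraph` on `ℓ²(PSL₂(ℤ))`:
`(L f)(x) = f x - f (x a) / 2 - f (x b) / 4 - f (x b⁻¹) / 4`. That its matrix coefficients are
those of the normalized Laplacian of the weighted graph is `laplacian_hasSum` below. -/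
def laplacian : ell2 PSL(2, ℤ) →L[ℂ] ell2 PSL(2, ℤ) :=
  1 - (1 / 2 : ℂ) • translate a - (1 / 4 : ℂ) • translate b - (1 / 4 : ℂ) • translate b⁻¹

theorem laplacian_apply (f : ell2 PSL(2, ℤ)) (x : PSL(2, ℤ)) :
    (laplacian f : PSL(2, ℤ) → ℂ) x =
      f x - 1 / 2 * f (x * a) - 1 / 4 * f (x * b) - 1 / 4 * f (x * b⁻¹) := rfl

theorem a_mul_a : a * a = 1 := by
  rw [a, ← QuotientGroup.mk_mul, QuotientGroup.eq_one_iff,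
    Matrix.SpecialLinearGroup.mem_center_iff]
  exact ⟨-1, by norm_num, by ext i j; fin_cases i <;> fin_cases j <;> simp [coe_aMat]⟩

theorem b_pow_three : b ^ 3 = 1 := by
  rw [b, ← QuotientGroup.mk_pow, QuotientGroup.eq_one_iff,
    Matrix.SpecialLinearGroup.mem_center_iff]
  exact ⟨-1, by norm_num, by
    ext i j; fin_cases i <;> fin_cases j <;> simp [coe_bMat, pow_succ]⟩

open Classical in
theorem modularGraph_w (x y : PSL(2, ℤ)) :
    modularGraph.w x y = (if y = x * a then 2 else 0) + (if y = x * b then 1 else 0)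
      + (if y = x * b⁻¹ then 1 else 0) := by
  have h1 : y * a = x ↔ y = x * a := by
    constructor
    · rintro rfl; rw [mul_assoc, a_mul_a, mul_one]
    · rintro rfl; rw [mul_assoc, a_mul_a, mul_one]
  have h2 : y * b = x ↔ y = x * b⁻¹ := eq_mul_inv_iff_mul_eq.symm
  simp only [modularGraph, cayleyGraph, Fin.sum_univ_two, Matrix.cons_val_zero,
    Matrix.cons_val_one, h1, h2, eq_comm (a := x * a) (b := y), eq_comm (a := x * b) (b := y)]
  split_ifs <;> norm_num

theorem modularGraph_degree (x : PSL(2, ℤ)) : modularGraph.degree x = 4 := by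
  classical
  have h := ((hasSum_ite_eq (x * a) (2 : ℝ)).add (hasSum_ite_eq (x * b) (1 : ℝ))).add
    (hasSum_ite_eq (x * b⁻¹) (1 : ℝ))
  rw [WeightedGraph.degree, tsum_congr (modularGraph_w x)]
  refine (HasSum.tsum_eq ?_).trans (by norm_num : (2 + 1 + 1 : ℝ) = 4)
  convert h

/-- `laplacian` is the operator with the matrix coefficients of the normalized Laplacian. -/
theorem laplacian_hasSum (f : ell2 PSL(2, ℤ)) (x : PSL(2, ℤ)) :
    HasSum (fun y => (modularGraph.normLaplacianCoeff x y : ℂ) * f y)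
      ((laplacian f : PSL(2, ℤ) → ℂ) x) := by
  classical
  have h := (((hasSum_ite_eq x (f x)).sub (hasSum_ite_eq (x * a) (1 / 2 * f (x * a)))).sub
    (hasSum_ite_eq (x * b) (1 / 4 * f (x * b)))).sub
    (hasSum_ite_eq (x * b⁻¹) (1 / 4 * f (x * b⁻¹)))
  rw [laplacian_apply]
  refine Eq.mp (congrArg (fun F => HasSum F _) (funext fun y => ?_)) h
  have h4 : √((4 : ℝ) * 4) = 4 := Real.sqrt_mul_self (by norm_num)
  have e1 : (if y = x * a then 1 / 2 * f (x * a) else 0) = (if y = x * a then 1 / 2 else 0) * f y := by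
    split_ifs with h <;> simp [h]
  have e2 : (if y = x * b then 1 / 4 * f (x * b) else 0) = (if y = x * b then 1 / 4 else 0) * f y := by
    split_ifs with h <;> simp [h]
  have e3 : (if y = x * b⁻¹ then 1 / 4 * f (x * b⁻¹) else 0)
      = (if y = x * b⁻¹ then 1 / 4 else 0) * f y := by
    split_ifs with h <;> simp [h]
  have e0 : (if y = x then f x else 0) = (if y = x then 1 else 0) * f y := by
    split_ifs with h <;> simp [h]
  simp only [e0, e1, e2, e3]
  rw [WeightedGraph.normLaplacianCoeff, modularGraph_degree, modularGraph_degree, h4, modularGraph_w, eq_comm (a := x) (b := y), ← sub_mul, ← sub_mul, ← sub_mul]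
  congr 1
  push_cast
  split_ifs <;> norm_num

/-! ### The endpoints -/

/-- `λ₀ = 7/8 - ½ √(25/16 + √2)` -/
def lambda0 : ℝ := 7 / 8 - 1 / 2 * √(25 / 16 + √2)

/-- `λ₁ = 7/8 + ½ √(25/16 - √2)` -/
def lambda1 : ℝ := 7 / 8 + 1 / 2 * √(25 / 16 - √2)

end ModularCayley

end

/-!
Let `A` be the right translation by `a` and `P` the orthogonal projection onto the functions
constant on the triangles `x⟨b⟩`, so that the Laplacian is `5/4 - A/2 - (3/4) P`. It is
self-adjoint, so only real spectral parameters `r` matter.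

For `r ≠ 3/4, 7/4` the operator `5/4 - r - A/2` is invertible, because `A² = 1`, and by the
equivalence of the invertibility of `1 - xy` and of `1 - yx` the invertibility of the Laplacian
minus `r` reduces to that of `(1 - P) + α P + β P A P` for explicit real numbers `α`, `β`. On the
range of `P` the operator `P A P` is a third of the adjacency operator of the 3-regular tree of
triangles, so `‖P A P‖ ≤ 2√2/3` (`norm_avg_translate_avg_le`). This is a Schur test; its weights
come from directing the edges of the tree towards an end, which is made concrete by the sign of
the image of `√2` under Möbius transformations. The condition `|β| 2√2/3 < |α|` is
`√2/4 < |(r - 7/8)² - 25/64|`, the complement of the bands (`isUnit_laplacian_sub`).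

Conversely, suppose that the Laplacian minus `r` is onto, and let `φ` be a preimage of the point
mass at `b`. The sums of `φ (b x) - φ (b⁻¹ x)` over the words `x` of length `n` in the free monoid
on `ab` and `ab⁻¹`, which is the monoid of matrices with non-negative entries, are `o(2 ^ (n / 2))`
by the Cauchy–Schwarz inequality (`tendsto_sum_level`) and satisfy a three-term recurrence with
constant coefficients. If `r` is in a band, a quadratic form that doubles at each step shows that
only the zero solution is this small; if `r` is `3/4` or `7/4`, there is one small solution up to
scaling. Neither satisfies the inhomogeneous equation at the origin (`false_of_recurrence`).
-/

noncomputable section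

namespace ModularCayley

/-! ### Representing elements of `PSL₂(ℤ)` by matrices -/

theorem exists_mk (x : PSL(2, ℤ)) : ∃ M : SL(2, ℤ), (QuotientGroup.mk M : PSL(2, ℤ)) = x :=
  QuotientGroup.mk_surjective x

/-- Two matrices represent the same element of `PSL₂(ℤ)` only if they agree up to sign. -/
theorem eq_or_eq_neg_of_mk_eq {M N : SL(2, ℤ)}
    (h : (QuotientGroup.mk M : PSL(2, ℤ)) = QuotientGroup.mk N) :
    (∀ i j, N i j = M i j) ∨ (∀ i j, N i j = -M i j) := by
  rw [QuotientGroup.eq, Matrix.SpecialLinearGroup.mem_center_iff] at h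
  obtain ⟨r, hr, h⟩ := h
  have hN : (N : Matrix (Fin 2) (Fin 2) ℤ) = r • (M : Matrix (Fin 2) (Fin 2) ℤ) := by
    have h1 : N = M * (M⁻¹ * N) := by group
    rw [h1, Matrix.SpecialLinearGroup.coe_mul, ← h, Matrix.smul_eq_mul_diagonal]
    rfl
  have hr' : r = 1 ∨ r = -1 := by
    rw [Fintype.card_fin] at hr
    simpa using hr
  rcases hr' with rfl | rfl
  · left; intro i j; simp [hN]
  · right; intro i j; simp [hN]

theorem det_eq (M : SL(2, ℤ)) : M 0 0 * M 1 1 - M 0 1 * M 1 0 = 1 := by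
  have := M.det_coe
  rwa [Matrix.det_fin_two] at this

theorem inv_bMat_coe : ((bMat⁻¹ : SL(2, ℤ)) : Matrix (Fin 2) (Fin 2) ℤ) = !![1, 1; -1, 0] := by
  rw [Matrix.SpecialLinearGroup.coe_inv, coe_bMat, Matrix.adjugate_fin_two]
  simp

theorem mul_aMat (M : SL(2, ℤ)) :
    ((M * aMat : SL(2, ℤ)) : Matrix (Fin 2) (Fin 2) ℤ) = !![M 0 1, -M 0 0; M 1 1, -M 1 0] := by
  rw [Matrix.SpecialLinearGroup.coe_mul, coe_aMat]
  ext i j; fin_cases i <;> fin_cases j <;> simp [Matrix.mul_apply, Fin.sum_univ_two]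

theorem mul_bMat (M : SL(2, ℤ)) :
    ((M * bMat : SL(2, ℤ)) : Matrix (Fin 2) (Fin 2) ℤ) =
      !![M 0 1, M 0 1 - M 0 0; M 1 1, M 1 1 - M 1 0] := by
  rw [Matrix.SpecialLinearGroup.coe_mul, coe_bMat]
  ext i j; fin_cases i <;> fin_cases j <;> simp [Matrix.mul_apply, Fin.sum_univ_two] <;> ring

theorem mul_inv_bMat (M : SL(2, ℤ)) :
    ((M * bMat⁻¹ : SL(2, ℤ)) : Matrix (Fin 2) (Fin 2) ℤ) =
      !![M 0 0 - M 0 1, M 0 0; M 1 0 - M 1 1, M 1 0] := by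
  rw [Matrix.SpecialLinearGroup.coe_mul, inv_bMat_coe]
  ext i j; fin_cases i <;> fin_cases j <;> simp [Matrix.mul_apply, Fin.sum_univ_two] <;> ring

theorem mk_mul_a (M : SL(2, ℤ)) :
    (QuotientGroup.mk M : PSL(2, ℤ)) * a = QuotientGroup.mk (M * aMat) := rfl

theorem mk_mul_b (M : SL(2, ℤ)) :
    (QuotientGroup.mk M : PSL(2, ℤ)) * b = QuotientGroup.mk (M * bMat) := rfl

theorem mk_mul_inv_b (M : SL(2, ℤ)) :
    (QuotientGroup.mk M : PSL(2, ℤ)) * b⁻¹ = QuotientGroup.mk (M * bMat⁻¹) := rfl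

theorem inv_a : a⁻¹ = a := inv_eq_of_mul_eq_one_left a_mul_a

theorem b_mul_b : b * b = b⁻¹ :=
  eq_inv_of_mul_eq_one_left (by rw [← b_pow_three, pow_succ, pow_two])

theorem inv_b_mul_inv_b : b⁻¹ * b⁻¹ = b := by
  rw [← mul_inv_rev, b_mul_b, inv_inv]

/-! ### Directing the tree of triangles towards an end -/

/-- The set of `x ∈ PSL₂(ℤ)` such that the Möbius transformation `x⁻¹` sends the boundary point
`√2` to a positive real number. The two homogeneous coordinates of `x⁻¹ √2`, for a matrix
representing `x`, are the two factors. -/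
def upward : Set PSL(2, ℤ) :=
  {x | ∃ M : SL(2, ℤ), (QuotientGroup.mk M : PSL(2, ℤ)) = x ∧
    0 < (M 1 1 * √2 - M 0 1) * (M 0 0 - M 1 0 * √2)}

theorem mk_mem_upward {M : SL(2, ℤ)} : (QuotientGroup.mk M : PSL(2, ℤ)) ∈ upward ↔
    0 < (M 1 1 * √2 - M 0 1) * (M 0 0 - M 1 0 * √2) := by
  refine ⟨?_, fun h => ⟨M, rfl, h⟩⟩
  rintro ⟨N, hN, h⟩
  rcases eq_or_eq_neg_of_mk_eq hN with e | e
  · simpa only [e] using h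
  · simp only [e]; push_cast; linarith

theorem int_mul_sqrt_two_sub_ne_zero {m n : ℤ} (h : m ≠ 0 ∨ n ≠ 0) : (m * √2 - n : ℝ) ≠ 0 := by
  intro h0
  by_cases hm : m = 0
  · simp_all
  · exact ((irrational_sqrt_two.intCast_mul hm).sub_intCast n).ne_zero h0

/-- The homogeneous coordinates of `x⁻¹ √2` do not vanish, nor does their sum. -/
theorem coord_ne_zero (M : SL(2, ℤ)) :
    (M 1 1 * √2 - M 0 1 : ℝ) ≠ 0 ∧ (M 0 0 - M 1 0 * √2 : ℝ) ≠ 0 ∧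
      ((M 1 1 * √2 - M 0 1) + (M 0 0 - M 1 0 * √2) : ℝ) ≠ 0 := by
  have hd := det_eq M
  refine ⟨int_mul_sqrt_two_sub_ne_zero ?_, ?_, ?_⟩
  · by_contra! h; simp [h.1, h.2] at hd
  · have : (M 1 0 * √2 - M 0 0 : ℝ) ≠ 0 := int_mul_sqrt_two_sub_ne_zero (by
      by_contra! h; simp [h.1, h.2] at hd)
    intro h; apply this; linarith
  · have := int_mul_sqrt_two_sub_ne_zero (m := M 1 1 - M 1 0) (n := M 0 1 - M 0 0) (by
      by_contra! h
      rw [sub_eq_zero.1 h.1, sub_eq_zero.1 h.2] at hd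
      linarith)
    intro h; apply this; push_cast; linarith

theorem mul_a_mem_upward (x : PSL(2, ℤ)) : x * a ∈ upward ↔ x ∉ upward := by
  obtain ⟨M, rfl⟩ := exists_mk x
  obtain ⟨h1, h2, -⟩ := coord_ne_zero M
  rw [mk_mul_a, mk_mem_upward, mk_mem_upward, mul_aMat, not_lt]
  have h3 := mul_ne_zero h1 h2
  simp only [Matrix.of_apply, Matrix.cons_val', Matrix.cons_val_zero, Matrix.cons_val_one,
    Matrix.cons_val_fin_one]
  push_cast
  constructor
  · intro h; linarith
  · intro h; have := lt_of_le_of_ne h h3; linarith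

/-- Each coset of `⟨b⟩` contains exactly one element of `upward`, since the rotation `b` of order
three permutes the arcs `(0, ∞)`, `(-1, 0)` and `(-∞, -1)` of the boundary cyclically. -/
theorem coset_upward (x : PSL(2, ℤ)) :
    (x ∈ upward ∧ x * b ∉ upward ∧ x * b⁻¹ ∉ upward) ∨
    (x ∉ upward ∧ x * b ∈ upward ∧ x * b⁻¹ ∉ upward) ∨
    (x ∉ upward ∧ x * b ∉ upward ∧ x * b⁻¹ ∈ upward) := by
  obtain ⟨M, rfl⟩ := exists_mk x
  obtain ⟨h1, h2, h3⟩ := coord_ne_zero M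
  rw [mk_mul_b, mk_mul_inv_b, mk_mem_upward, mk_mem_upward, mk_mem_upward, mul_bMat,
    mul_inv_bMat]
  simp only [Matrix.of_apply, Matrix.cons_val', Matrix.cons_val_zero, Matrix.cons_val_one,
    Matrix.cons_val_fin_one]
  push_cast
  generalize e1 : (M 1 1 * √2 - M 0 1 : ℝ) = u at *
  generalize e2 : (M 0 0 - M 1 0 * √2 : ℝ) = v at *
  have e3 : ((M 1 1 - M 1 0) * √2 - (M 0 1 - M 0 0) : ℝ) = u + v := by rw [← e1, ← e2]; ring
  have e4 : ((M 0 1 : ℝ) - M 1 1 * √2 : ℝ) = -u := by rw [← e1]; ring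
  have e5 : (M 1 0 * √2 - M 0 0 : ℝ) = -v := by rw [← e2]; ring
  have e6 : ((M 0 0 : ℝ) - M 0 1 - (M 1 0 - M 1 1) * √2 : ℝ) = u + v := by rw [← e1, ← e2]; ring
  rw [e3, e4, e5, e6]
  simp only [mul_pos_iff, not_or, not_and, not_lt]
  grind

/-! ### Right translations as operators -/

theorem hasSum_norm_sq {G : Type*} (f : ell2 G) : HasSum (fun x => ‖f x‖ ^ 2) (‖f‖ ^ 2) := by
  have := lp.hasSum_norm (p := 2) (by norm_num) f
  simpa using this

section Translate

variable {G : Type*} [Group G]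

theorem translate_one : translate (1 : G) = 1 := by
  ext f x; simp

theorem translate_mul (g h : G) : translate g * translate h = translate (g * h) := by
  ext f x
  simp [mul_assoc]

theorem norm_translate_le (g : G) : ‖translate g‖ ≤ 1 :=
  LinearMap.mkContinuous_norm_le _ zero_le_one _

theorem adjoint_translate (g : G) :
    ContinuousLinearMap.adjoint (translate g) = translate g⁻¹ := by
  symm
  rw [ContinuousLinearMap.eq_adjoint_iff]
  intro f h
  rw [lp.inner_eq_tsum, lp.inner_eq_tsum, ← (Equiv.mulRight g).tsum_eq]
  simp

end Translate

/-- The orthogonal projection of `ℓ²(PSL₂(ℤ))` onto the functions constant on the triangles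
`x⟨b⟩`: the average over the triangle. -/
def avg : ell2 PSL(2, ℤ) →L[ℂ] ell2 PSL(2, ℤ) :=
  (1 / 3 : ℂ) • (1 + translate b + translate b⁻¹)

theorem avg_apply (f : ell2 PSL(2, ℤ)) (x : PSL(2, ℤ)) :
    avg f x = 1 / 3 * (f x + f (x * b) + f (x * b⁻¹)) := rfl

theorem translate_a_sq : translate a * translate a = 1 := by
  rw [translate_mul, a_mul_a, translate_one]

theorem avg_mul_translate_b : avg * translate b = avg := by
  simp only [avg, smul_mul_assoc, add_mul, translate_mul, one_mul, b_mul_b, inv_mul_cancel,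
    translate_one]
  abel_nf

theorem avg_mul_translate_inv_b : avg * translate b⁻¹ = avg := by
  simp only [avg, smul_mul_assoc, add_mul, translate_mul, one_mul, inv_b_mul_inv_b,
    mul_inv_cancel, translate_one]
  abel_nf

theorem avg_mul_avg : avg * avg = avg := by
  conv_lhs => rhs; rw [avg]
  rw [mul_smul_comm, mul_add, mul_add, avg_mul_translate_b, avg_mul_translate_inv_b, mul_one]
  module

theorem laplacian_eq :
    laplacian = (5 / 4 : ℂ) • 1 - (1 / 2 : ℂ) • translate a - (3 / 4 : ℂ) • avg := by
  rw [laplacian, avg]; module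

theorem isSelfAdjoint_laplacian : IsSelfAdjoint laplacian := by
  rw [ContinuousLinearMap.isSelfAdjoint_iff', laplacian]
  simp only [map_sub, map_smulₛₗ, adjoint_translate, inv_a, inv_inv]
  have h1 : ContinuousLinearMap.adjoint (1 : ell2 PSL(2, ℤ) →L[ℂ] ell2 PSL(2, ℤ)) = 1 :=
    star_one _
  rw [h1]
  simp only [map_div₀, map_one, map_ofNat]
  abel

theorem norm_avg_le : ‖avg‖ ≤ 1 := by
  have h : ‖(1 : ell2 PSL(2, ℤ) →L[ℂ] ell2 PSL(2, ℤ)) + translate b + translate b⁻¹‖ ≤ 3 := by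
    refine (norm_add₃_le).trans ?_
    have := norm_translate_le (1 : PSL(2, ℤ))
    rw [translate_one] at this
    linarith [norm_translate_le b, norm_translate_le b⁻¹]
  rw [avg, norm_smul]
  norm_num
  linarith

/-! ### The Schur test -/

open Classical in
/-- The weights of the Schur test for the averaged adjacency operator of the tree of triangles. -/
def schurWeight (x : PSL(2, ℤ)) : ℝ := if x ∈ upward then 4 else 2

theorem schurWeight_of_mem {x : PSL(2, ℤ)} (h : x ∈ upward) : schurWeight x = 4 := if_pos h

theorem schurWeight_of_notMem {x : PSL(2, ℤ)} (h : x ∉ upward) : schurWeight x = 2 := if_neg h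

theorem schurWeight_mul_a_of_mem {x : PSL(2, ℤ)} (h : x ∈ upward) : schurWeight (x * a) = 2 :=
  schurWeight_of_notMem fun h' => (mul_a_mem_upward x).1 h' h

theorem schurWeight_mul_a_of_notMem {x : PSL(2, ℤ)} (h : x ∉ upward) : schurWeight (x * a) = 4 :=
  schurWeight_of_mem ((mul_a_mem_upward x).2 h)

/-- Across the edges labelled `a` the three weights are `2, 4, 4` in some order, and
`1/2 + 1/4 + 1/4 = 1`, so this is the Cauchy–Schwarz inequality. -/
theorem sq_le_schurWeight (F : PSL(2, ℤ) → ℝ) (x : PSL(2, ℤ)) :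
    (F (x * a) + F (x * b * a) + F (x * b⁻¹ * a)) ^ 2 ≤
      schurWeight (x * a) * F (x * a) ^ 2 + schurWeight (x * b * a) * F (x * b * a) ^ 2 +
        schurWeight (x * b⁻¹ * a) * F (x * b⁻¹ * a) ^ 2 := by
  have hm := @schurWeight_mul_a_of_mem
  have hn := @schurWeight_mul_a_of_notMem
  rcases coset_upward x with ⟨h1, h2, h3⟩ | ⟨h1, h2, h3⟩ | ⟨h1, h2, h3⟩
  · rw [hm h1, hn h2, hn h3]
    nlinarith [sq_nonneg (F (x * a) - F (x * b * a) - F (x * b⁻¹ * a)),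
      sq_nonneg (F (x * b * a) - F (x * b⁻¹ * a))]
  · rw [hn h1, hm h2, hn h3]
    nlinarith [sq_nonneg (F (x * b * a) - F (x * a) - F (x * b⁻¹ * a)),
      sq_nonneg (F (x * a) - F (x * b⁻¹ * a))]
  · rw [hn h1, hn h2, hm h3]
    nlinarith [sq_nonneg (F (x * b⁻¹ * a) - F (x * a) - F (x * b * a)),
      sq_nonneg (F (x * a) - F (x * b * a))]

theorem sum_schurWeight (x : PSL(2, ℤ)) :
    schurWeight x + schurWeight (x * b) + schurWeight (x * b⁻¹) = 8 := by
  have hm := @schurWeight_of_mem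
  have hn := @schurWeight_of_notMem
  rcases coset_upward x with ⟨h1, h2, h3⟩ | ⟨h1, h2, h3⟩ | ⟨h1, h2, h3⟩
  · rw [hm h1, hn h2, hn h3]; norm_num
  · rw [hn h1, hm h2, hn h3]; norm_num
  · rw [hn h1, hn h2, hm h3]; norm_num

theorem norm_avg_translate_le_of_invariant (f : ell2 PSL(2, ℤ)) (hb : ∀ x, f (x * b) = f x) :
    9 * ‖avg (translate a f)‖ ^ 2 ≤ 8 * ‖f‖ ^ 2 := by
  have hb' : ∀ x, f (x * b⁻¹) = f x := fun x => by rw [← hb (x * b⁻¹), inv_mul_cancel_right]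
  set w : PSL(2, ℤ) → ℝ := fun x => schurWeight x * ‖f x‖ ^ 2 with hw
  have hsum : Summable w := by
    refine Summable.of_nonneg_of_le (fun x => ?_) (fun x => ?_)
      ((hasSum_norm_sq f).summable.mul_left 4)
    · simp only [hw, schurWeight]; positivity
    · simp only [hw, schurWeight]
      gcongr
      split_ifs <;> norm_num
  obtain ⟨S, hS⟩ := hsum
  have shift : ∀ g : PSL(2, ℤ), HasSum (fun x => w (x * g)) S :=
    fun g => (Equiv.hasSum_iff (Equiv.mulRight g)).2 hS
  -- The weights of a triangle add up to `8`.
  have h3S : 3 * S = 8 * ‖f‖ ^ 2 := by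
    have h1 := ((shift 1).add (shift b)).add (shift b⁻¹)
    have h2 : HasSum (fun x => w (x * 1) + w (x * b) + w (x * b⁻¹)) (8 * ‖f‖ ^ 2) := by
      have e : (fun x => w (x * 1) + w (x * b) + w (x * b⁻¹)) = fun x => 8 * ‖f x‖ ^ 2 := by
        funext x
        simp only [hw, hb, hb', mul_one, ← add_mul, sum_schurWeight]
      rw [e]
      exact (hasSum_norm_sq f).mul_left 8
    linarith [h1.unique h2]
  have h2 : HasSum (fun x => w (x * a) + w (x * b * a) + w (x * b⁻¹ * a)) (S + S + S) := by
    simpa only [mul_assoc] using ((shift a).add (shift (b * a))).add (shift (b⁻¹ * a))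
  have h4 : 9 * ‖avg (translate a f)‖ ^ 2 ≤ S + S + S := by
    refine hasSum_le (fun x => ?_) ((hasSum_norm_sq (avg (translate a f))).mul_left 9) h2
    refine le_trans ?_ (sq_le_schurWeight (fun x => ‖f x‖) x)
    have h5 := norm_add₃_le (a := f (x * a)) (b := f (x * b * a)) (c := f (x * b⁻¹ * a))
    rw [avg_apply, norm_mul, mul_pow]
    simp only [translate_apply]
    have h6 := pow_le_pow_left₀ (norm_nonneg _) h5 2
    norm_num
    linarith
  linarith

theorem norm_avg_translate_avg_le : ‖avg * translate a * avg‖ ≤ 2 * √2 / 3 := by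
  refine ContinuousLinearMap.opNorm_le_bound _ (by positivity) fun g => ?_
  have hb : ∀ x, avg g (x * b) = avg g x := fun x => by
    have e : x * b * b = x * b⁻¹ := by rw [mul_assoc, b_mul_b]
    rw [avg_apply, avg_apply, e, mul_inv_cancel_right]
    ring
  have h1 := norm_avg_translate_le_of_invariant (avg g) hb
  have h2 : ‖avg g‖ ≤ ‖g‖ := by
    simpa using avg.le_of_opNorm_le norm_avg_le g
  have h3 : ‖avg (translate a (avg g))‖ ^ 2 ≤ (2 * √2 / 3 * ‖g‖) ^ 2 := by
    have : (2 * √2 / 3 * ‖g‖) ^ 2 = 8 / 9 * ‖g‖ ^ 2 := by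
      rw [mul_pow, div_pow, mul_pow, Real.sq_sqrt (by norm_num)]; ring
    have h4 : ‖avg g‖ ^ 2 ≤ ‖g‖ ^ 2 := by gcongr
    linarith
  exact (sq_le_sq₀ (norm_nonneg _) (by positivity)).1 h3

/-! ### The resolvent outside the bands -/

theorem isUnit_one_sub_mul_comm {A : Type*} [Ring A] [Algebra ℂ A] {x y : A}
    (h : IsUnit (1 - x * y)) : IsUnit (1 - y * x) := by
  have := (spectrum.unit_mem_mul_comm (R := ℂ) (a := x) (b := y) (r := 1)).not
  simpa [spectrum.mem_iff] using this.1 (by simpa [spectrum.mem_iff] using h)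

/-- A spectral parameter `r` away from the two eigenvalues and from the bands is in the resolvent
set: as `5/4 - r - A/2` is invertible, where `A` is the translation by `a`, the invertibility of
`laplacian - r` reduces to that of a small perturbation on the range of `avg`. -/
theorem isUnit_laplacian_sub {r : ℝ} (h1 : r ≠ 3 / 4) (h2 : r ≠ 7 / 4)
    (h : √2 / 4 < |(r - 7 / 8) ^ 2 - 25 / 64|) :
    IsUnit (laplacian - (r : ℂ) • 1) := by
  set μ : ℝ := 5 / 4 - r with hμ
  set Δ : ℝ := μ ^ 2 - 1 / 4 with hΔ
  have hΔ0 : Δ ≠ 0 := by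
    have : Δ = (3 / 4 - r) * (7 / 4 - r) := by rw [hΔ, hμ]; ring
    rw [this]
    exact mul_ne_zero (sub_ne_zero.2 h1.symm) (sub_ne_zero.2 h2.symm)
  have hΔC : (Δ : ℂ) ≠ 0 := by exact_mod_cast hΔ0
  set A := translate a
  have hA : A * A = 1 := translate_a_sq
  set M := avg * A * avg with hM
  -- `X` and `Y` are the operator `5/4 - r - A/2` and its inverse.
  set X := (μ : ℂ) • (1 : ell2 PSL(2, ℤ) →L[ℂ] ell2 PSL(2, ℤ)) - (1 / 2 : ℂ) • A with hX
  set Y := (Δ : ℂ)⁻¹ • ((μ : ℂ) • (1 : ell2 PSL(2, ℤ) →L[ℂ] ell2 PSL(2, ℤ)) + (1 / 2 : ℂ) • A)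
    with hY
  have hD : (μ : ℂ) * μ - 1 / 4 = Δ := by rw [hΔ]; push_cast; ring
  have hXY : X * Y = 1 := by
    have : X * Y = ((Δ : ℂ)⁻¹ * ((μ : ℂ) * μ - 1 / 4)) • 1 := by
      rw [hX, hY]
      simp only [mul_smul_comm, smul_mul_assoc, sub_mul, mul_add, one_mul, mul_one, hA]
      module
    rw [this, hD, inv_mul_cancel₀ hΔC, one_smul]
  have hYX : Y * X = 1 := by
    have : Y * X = ((Δ : ℂ)⁻¹ * ((μ : ℂ) * μ - 1 / 4)) • 1 := by
      rw [hX, hY]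
      simp only [mul_smul_comm, smul_mul_assoc, mul_sub, add_mul, one_mul, mul_one, hA]
      module
    rw [this, hD, inv_mul_cancel₀ hΔC, one_smul]
  have hXu : IsUnit X := ⟨⟨X, Y, hXY, hYX⟩, rfl⟩
  have e1 : laplacian - (r : ℂ) • 1 = X * (1 - ((3 / 4 : ℂ) • (Y * avg)) * avg) := by
    rw [mul_sub, mul_one, smul_mul_assoc, mul_assoc, avg_mul_avg, mul_smul_comm, ← mul_assoc, hXY,
      one_mul, laplacian_eq, hX, hμ]
    push_cast
    module
  rw [e1]
  refine hXu.mul (isUnit_one_sub_mul_comm ?_)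
  set α : ℝ := 1 - 3 / 4 * μ / Δ with hα
  set β : ℝ := - 3 / 8 / Δ with hβ
  have key : |β| * (2 * √2 / 3) < |α| := by
    have e2 : α = ((r - 7 / 8) ^ 2 - 25 / 64) / Δ := by
      rw [hα]; field_simp; rw [hΔ, hμ]; ring
    rw [e2, hβ, abs_div _ Δ, abs_div _ Δ, div_mul_eq_mul_div]
    have : |(-3 / 8 : ℝ)| = 3 / 8 := by norm_num [abs_div]
    rw [this]
    have := abs_pos.2 hΔ0
    gcongr
    linarith
  have hα0 : α ≠ 0 := by
    rw [← abs_pos]; exact lt_of_le_of_lt (by positivity) key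
  have hαC : (α : ℂ) ≠ 0 := by exact_mod_cast hα0
  have hPM : avg * M = M := by rw [hM, ← mul_assoc, ← mul_assoc, avg_mul_avg]
  -- On the range of `avg` this is `α + β M`, and off it the identity.
  have e3 : 1 - avg * ((3 / 4 : ℂ) • (Y * avg)) =
      ((1 - avg) + (α : ℂ) • avg) * (1 - (-(β / α : ℝ) : ℂ) • M) := by
    have : avg * (Y * avg) = (Δ : ℂ)⁻¹ • ((μ : ℂ) • avg + (1 / 2 : ℂ) • M) := by
      rw [hY, hM]
      simp only [mul_smul_comm, smul_mul_assoc, mul_add, add_mul, one_mul, avg_mul_avg, mul_assoc]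
    rw [mul_smul_comm, this]
    simp only [mul_sub, add_mul, sub_mul, mul_one, one_mul, mul_smul_comm, smul_mul_assoc, hPM]
    have e4 : (α : ℂ) * (β / α : ℝ) = β := by push_cast; field_simp
    have e5 : (α : ℂ) = 1 - 3 / 4 * μ * (Δ : ℂ)⁻¹ := by
      rw [hα]; push_cast; ring
    have e6 : (β : ℂ) = - 3 / 8 * (Δ : ℂ)⁻¹ := by rw [hβ]; push_cast; ring
    have e7 : 1 - avg + (α : ℂ) • avg - -((β / α : ℝ) : ℂ) • (M - M + (α : ℂ) • M) =
        1 - avg + (α : ℂ) • avg + ((α : ℂ) * (β / α : ℝ)) • M := by module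
    rw [e7, e4, e6, e5]
    module
  have inv_eq : ∀ c d : ℂ, c * d = 1 → ((1 - avg) + c • avg) * ((1 - avg) + d • avg) = 1 := by
    intro c d hcd
    have : ((1 - avg) + c • avg) * ((1 - avg) + d • avg) = (1 - avg) + (c * d) • avg := by
      simp only [mul_add, add_mul, mul_sub, sub_mul, mul_one, one_mul, mul_smul_comm,
        smul_mul_assoc, avg_mul_avg]
      module
    rw [this, hcd, one_smul, sub_add_cancel]
  rw [e3]
  refine IsUnit.mul ⟨⟨_, (1 - avg) + (α : ℂ)⁻¹ • avg, ?_, ?_⟩, rfl⟩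
    (isUnit_one_sub_of_norm_lt_one ?_)
  · exact inv_eq _ _ (mul_inv_cancel₀ hαC)
  · exact inv_eq _ _ (inv_mul_cancel₀ hαC)
  · rw [norm_smul, norm_neg, Complex.norm_real, Real.norm_eq_abs, abs_div]
    calc |β| / |α| * ‖M‖ ≤ |β| / |α| * (2 * √2 / 3) := by
          gcongr; exact norm_avg_translate_avg_le
      _ < 1 := by
          rw [div_mul_eq_mul_div, div_lt_one (abs_pos.2 hα0)]; exact key

/-! ### The free monoid on `ab` and `ab⁻¹` -/

open Classical in
/-- The products of `n` factors from `{ab, ab⁻¹}`. -/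
def level : ℕ → Finset PSL(2, ℤ)
  | 0 => {1}
  | n + 1 => (level n).image (· * (a * b)) ∪ (level n).image (· * (a * b⁻¹))

theorem mk_neg (M : SL(2, ℤ)) :
    (QuotientGroup.mk (-M) : PSL(2, ℤ)) = QuotientGroup.mk M := by
  rw [QuotientGroup.eq, Matrix.SpecialLinearGroup.mem_center_iff]
  refine ⟨-1, by norm_num, ?_⟩
  have : (-M)⁻¹ * M = -1 := by
    rw [inv_mul_eq_iff_eq_mul]; simp
  rw [this]
  ext i j; fin_cases i <;> fin_cases j <;> simp

/-- Right multiplication by `ab` adds the first column of a matrix to the second one. -/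
theorem exists_mk_mul_ab (M : SL(2, ℤ)) : ∃ N : SL(2, ℤ),
    (QuotientGroup.mk N : PSL(2, ℤ)) = QuotientGroup.mk M * (a * b) ∧
      ∀ i, N i 0 = M i 0 ∧ N i 1 = M i 0 + M i 1 := by
  refine ⟨-(M * aMat * bMat), ?_, ?_⟩
  · rw [mk_neg, ← mul_assoc, mk_mul_a, mk_mul_b]
  · intro i
    rw [Matrix.SpecialLinearGroup.coe_neg, mul_bMat, mul_aMat]
    fin_cases i <;> simp <;> ring

/-- Right multiplication by `ab⁻¹` adds the second column of a matrix to the first one. -/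
theorem exists_mk_mul_ab_inv (M : SL(2, ℤ)) : ∃ N : SL(2, ℤ),
    (QuotientGroup.mk N : PSL(2, ℤ)) = QuotientGroup.mk M * (a * b⁻¹) ∧
      ∀ i, N i 0 = M i 0 + M i 1 ∧ N i 1 = M i 1 := by
  refine ⟨M * aMat * bMat⁻¹, ?_, ?_⟩
  · rw [← mul_assoc, mk_mul_a, mk_mul_inv_b]
  · intro i
    rw [mul_inv_bMat, mul_aMat]
    fin_cases i <;> simp <;> ring

/-- The elements of the monoid are represented by matrices with non-negative entries, and the
inner product of the two columns grows with the word length. -/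
theorem exists_nonneg_of_mem_level {n : ℕ} : ∀ {x : PSL(2, ℤ)}, x ∈ level n →
    ∃ M : SL(2, ℤ), (QuotientGroup.mk M : PSL(2, ℤ)) = x ∧ (∀ i j, 0 ≤ M i j) ∧
      (n : ℤ) ≤ M 0 0 * M 0 1 + M 1 0 * M 1 1 := by
  induction n with
  | zero =>
    intro x hx
    rw [level, Finset.mem_singleton] at hx
    refine ⟨1, hx.symm, fun i j => ?_, by simp⟩
    fin_cases i <;> fin_cases j <;> simp
  | succ n ih =>
    intro x hx
    classical
    rw [level, Finset.mem_union, Finset.mem_image, Finset.mem_image] at hx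
    rcases hx with ⟨y, hy, rfl⟩ | ⟨y, hy, rfl⟩ <;> obtain ⟨M, rfl, hM, hn⟩ := ih hy <;>
      have hd := det_eq M
    · obtain ⟨N, hN, e⟩ := exists_mk_mul_ab M
      refine ⟨N, hN, fun i j => ?_, ?_⟩
      · fin_cases j
        · simpa [(e i).1] using hM i 0
        · simpa [(e i).2] using add_nonneg (hM i 0) (hM i 1)
      · rw [(e 0).1, (e 0).2, (e 1).1, (e 1).2]
        have h : 1 ≤ M 0 0 * M 0 0 + M 1 0 * M 1 0 := by
          by_contra! h
          have h0 : M 0 0 = 0 := by nlinarith [hM 0 0, hM 1 0]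
          have h1 : M 1 0 = 0 := by nlinarith [hM 0 0, hM 1 0]
          simp [h0, h1] at hd
        push_cast
        linarith
    · obtain ⟨N, hN, e⟩ := exists_mk_mul_ab_inv M
      refine ⟨N, hN, fun i j => ?_, ?_⟩
      · fin_cases j
        · simpa [(e i).1] using add_nonneg (hM i 0) (hM i 1)
        · simpa [(e i).2] using hM i 1
      · rw [(e 0).1, (e 0).2, (e 1).1, (e 1).2]
        have h : 1 ≤ M 0 1 * M 0 1 + M 1 1 * M 1 1 := by
          by_contra! h
          have h0 : M 0 1 = 0 := by nlinarith [hM 0 1, hM 1 1]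
          have h1 : M 1 1 = 0 := by nlinarith [hM 0 1, hM 1 1]
          simp [h0, h1] at hd
        push_cast
        linarith

/-- A matrix having two entries with strictly opposite signs, such as those of `b⁻¹`, `a` and
`b⁻¹a`, does not represent an element of the monoid. -/
theorem mk_notMem_level {M : SL(2, ℤ)} {i j k l : Fin 2} (h : M i j * M k l < 0)
    (n : ℕ) : (QuotientGroup.mk M : PSL(2, ℤ)) ∉ level n := by
  intro hM
  obtain ⟨N, hN, h0, -⟩ := exists_nonneg_of_mem_level hM
  have h1 := mul_nonneg (h0 i j) (h0 k l)
  rcases eq_or_eq_neg_of_mk_eq hN with e | e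
  · rw [e, e] at h; linarith
  · rw [e, e] at h; linarith

theorem inv_b_notMem_level (n : ℕ) : b⁻¹ ∉ level n :=
  mk_notMem_level (M := bMat⁻¹) (i := 0) (j := 0) (k := 1) (l := 0)
    (by rw [inv_bMat_coe]; norm_num) n

theorem a_notMem_level (n : ℕ) : a ∉ level n :=
  mk_notMem_level (M := aMat) (i := 0) (j := 1) (k := 1) (l := 0)
    (by rw [coe_aMat]; norm_num) n

theorem inv_b_mul_a_notMem_level (n : ℕ) : b⁻¹ * a ∉ level n :=
  mk_notMem_level (M := bMat⁻¹ * aMat) (i := 0) (j := 0) (k := 0) (l := 1)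
    (by rw [mul_aMat, inv_bMat_coe]; norm_num) n

/-- An element lies in only finitely many levels: the inner product of the columns of a matrix
representing it bounds the word length. -/
theorem eventually_notMem_level (x : PSL(2, ℤ)) : ∀ᶠ n in Filter.atTop, x ∉ level n := by
  obtain ⟨M, rfl⟩ := exists_mk x
  filter_upwards [Filter.eventually_gt_atTop (M 0 0 * M 0 1 + M 1 0 * M 1 1).toNat] with n hn hx
  obtain ⟨N, hN, -, h⟩ := exists_nonneg_of_mem_level hx
  have : M 0 0 * M 0 1 + M 1 0 * M 1 1 = N 0 0 * N 0 1 + N 1 0 * N 1 1 := by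
    rcases eq_or_eq_neg_of_mk_eq hN with e | e
    · simp only [e]
    · simp only [e]; ring
  omega

theorem one_notMem_level_succ (n : ℕ) : 1 ∉ level (n + 1) := by
  intro hx
  obtain ⟨N, hN, -, h⟩ := exists_nonneg_of_mem_level hx
  have h0 : ∀ i j, i ≠ j → N i j = 0 := by
    have hN' : (QuotientGroup.mk (1 : SL(2, ℤ)) : PSL(2, ℤ)) = QuotientGroup.mk N := hN.symm
    intro i j hij
    rcases eq_or_eq_neg_of_mk_eq hN' with e | e
    · rw [e]; simp [hij]
    · rw [e]; simp [hij]
  rw [h0 0 1 (by decide), h0 1 0 (by decide)] at h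
  push_cast at h
  linarith

/-- Words with different last letters are different: in one case the second column dominates the
first one, in the other case the first column dominates the second one. -/
theorem mul_ab_ne_mul_ab_inv {n : ℕ} {x y : PSL(2, ℤ)} (hx : x ∈ level n) (hy : y ∈ level n) :
    x * (a * b) ≠ y * (a * b⁻¹) := by
  intro h
  obtain ⟨M, rfl, hM, -⟩ := exists_nonneg_of_mem_level hx
  obtain ⟨N, rfl, hN, -⟩ := exists_nonneg_of_mem_level hy
  obtain ⟨M', hM', eM⟩ := exists_mk_mul_ab M
  obtain ⟨N', hN', eN⟩ := exists_mk_mul_ab_inv N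
  have hd := det_eq M
  rw [← hM', ← hN'] at h
  have hz : ∀ i, M i 1 = 0 := by
    intro i
    have h1 := hM i 0
    have h2 := hM i 1
    have h3 := hN i 0
    have h4 := hN i 1
    obtain ⟨e1, e2⟩ := eM i
    obtain ⟨e3, e4⟩ := eN i
    rcases eq_or_eq_neg_of_mk_eq h with e | e
    · have e5 := e i 0
      have e6 := e i 1
      omega
    · have e5 := e i 0
      have e6 := e i 1
      omega
  rw [hz 0, hz 1] at hd
  simp at hd

theorem sum_level_succ (n : ℕ) (f : PSL(2, ℤ) → ℝ) :
    ∑ x ∈ level (n + 1), f x = ∑ x ∈ level n, (f (x * (a * b)) + f (x * (a * b⁻¹))) := by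
  classical
  have hd : Disjoint ((level n).image (· * (a * b))) ((level n).image (· * (a * b⁻¹))) := by
    rw [Finset.disjoint_left]
    intro z hz hz'
    obtain ⟨x, hx, rfl⟩ := Finset.mem_image.1 hz
    obtain ⟨y, hy, h⟩ := Finset.mem_image.1 hz'
    exact mul_ab_ne_mul_ab_inv hx hy h.symm
  have e : level (n + 1) =
      (level n).image (· * (a * b)) ∪ (level n).image (· * (a * b⁻¹)) := by
    rw [level]
  rw [e, Finset.sum_union hd, Finset.sum_image fun x _ y _ h => mul_right_cancel h,
    Finset.sum_image fun x _ y _ h => mul_right_cancel h, Finset.sum_add_distrib]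

theorem card_level_le (n : ℕ) : (level n).card ≤ 2 ^ n := by
  classical
  induction n with
  | zero => simp [level]
  | succ n ih =>
    rw [level]
    refine (Finset.card_union_le _ _).trans ?_
    have h1 := Finset.card_image_le (s := level n) (f := (· * (a * b)))
    have h2 := Finset.card_image_le (s := level n) (f := (· * (a * b⁻¹)))
    rw [pow_succ]
    omega

/-- For a square-summable function, the sums over the levels are `o(2 ^ (n / 2))`, by the
Cauchy–Schwarz inequality. -/
theorem tendsto_sum_level {f : PSL(2, ℤ) → ℝ} (hf : Summable fun x => f x ^ 2) :
    Filter.Tendsto (fun n => (∑ x ∈ level n, f x) ^ 2 / 2 ^ n) Filter.atTop (nhds 0) := by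
  have h1 : Filter.Tendsto (fun n => ∑ x ∈ level n, f x ^ 2) Filter.atTop (nhds 0) := by
    rw [Metric.tendsto_nhds]
    intro ε hε
    obtain ⟨s, hs⟩ := summable_iff_vanishing_norm.1 hf ε hε
    have h2 : ∀ᶠ n in Filter.atTop, ∀ x ∈ s, x ∉ level n :=
      (Filter.eventually_all_finset s).2 fun x _ => eventually_notMem_level x
    filter_upwards [h2] with n hn
    rw [dist_zero_right]
    exact hs _ (Finset.disjoint_right.2 hn)
  refine squeeze_zero (fun n => by positivity) (fun n => ?_) h1
  rw [div_le_iff₀ (by positivity), mul_comm]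
  refine sq_sum_le_card_mul_sum_sq.trans ?_
  gcongr
  exact_mod_cast card_level_le n

/-! ### Small solutions of the recurrence along the levels -/

open Filter Topology in
/-- The sums over the levels of an antisymmetrized solution of `(laplacian - r) φ = δ` satisfy a
two-periodic Jacobi recurrence, inhomogeneous at the origin only, which has no solution of size
`o(2 ^ (n / 2))` when `r` is one of the exceptional values or lies in a band. -/
theorem false_of_recurrence {r : ℝ} {α γ : ℕ → ℝ}
    (h0 : (5 / 4 - r) * α 0 - 1 / 2 * γ 0 = 1)
    (h1 : ∀ n, (1 - r) * γ n - 1 / 2 * α n - 1 / 4 * α (n + 1) = 0)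
    (h2 : ∀ n, (3 / 4 - r) * α (n + 1) - 1 / 2 * γ (n + 1) - 1 / 2 * γ n = 0)
    (hα : Tendsto (fun n => α n ^ 2 / 2 ^ n) atTop (𝓝 0))
    (hr : r = 3 / 4 ∨ r = 7 / 4 ∨ |(r - 7 / 8) ^ 2 - 25 / 64| ≤ √2 / 4) : False := by
  set k : ℝ := 8 * ((r - 7 / 8) ^ 2 - 25 / 64) with hk
  have hrec : ∀ n, α (n + 2) = k * α (n + 1) - 2 * α n := by
    intro n
    rw [hk]
    linear_combination (-8 * (1 - r)) * h2 n - 4 * h1 (n + 1) - 4 * h1 n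
  have hα' : Tendsto (fun n => α (n + 1) ^ 2 / 2 ^ n) atTop (𝓝 0) := by
    have := ((tendsto_add_atTop_iff_nat 1).2 hα).const_mul 2
    rw [mul_zero] at this
    refine this.congr fun n => ?_
    rw [pow_succ]; field_simp; ring
  have hsum : Tendsto (fun n => α (n + 1) ^ 2 / 2 ^ n + α n ^ 2 / 2 ^ n) atTop (𝓝 0) := by
    simpa using hα'.add hα
  -- The characteristic roots are `ε` and `2ε`, and `(2ε) ^ n` is not `o(2 ^ (n / 2))`.
  have exceptional : ∀ ε : ℝ, ε ^ 2 = 1 → k = 3 * ε → α 1 = ε * α 0 := by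
    intro ε hε hkε
    have hv : ∀ n, (α (n + 1) - ε * α n) ^ 2 = 4 ^ n * (α 1 - ε * α 0) ^ 2 := by
      intro n
      induction n with
      | zero => simp
      | succ n ih =>
        have : α (n + 1 + 1) - ε * α (n + 1) = 2 * ε * (α (n + 1) - ε * α n) := by
          rw [hrec n, hkε]; linear_combination 2 * α n * hε
        rw [this, mul_pow, mul_pow, hε, ih, pow_succ]; ring
    have hle : ∀ n, (α 1 - ε * α 0) ^ 2 ≤
        2 * (α (n + 1) ^ 2 / 2 ^ n + α n ^ 2 / 2 ^ n) := by
      intro n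
      rw [← add_div, mul_div_assoc', le_div_iff₀ (by positivity)]
      have h4 : (2 : ℝ) ^ n ≤ 4 ^ n := by gcongr; norm_num
      have h5 := mul_le_mul_of_nonneg_right h4 (sq_nonneg (α 1 - ε * α 0))
      have h6 : (α (n + 1) - ε * α n) ^ 2 ≤ 2 * (α (n + 1) ^ 2 + α n ^ 2) := by
        have : (ε * α n) ^ 2 = α n ^ 2 := by rw [mul_pow, hε, one_mul]
        nlinarith [sq_nonneg (α (n + 1) + ε * α n)]
      linarith [hv n]
    have h3 := ge_of_tendsto' (hsum.const_mul 2) hle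
    rw [mul_zero] at h3
    have := pow_eq_zero_iff (two_ne_zero) |>.1 (le_antisymm h3 (sq_nonneg _))
    linarith
  rcases hr with rfl | rfl | hr
  · have := exceptional (-1) (by norm_num) (by rw [hk]; norm_num)
    have e := h1 0
    norm_num at e
    linarith
  · have := exceptional 1 (by norm_num) (by rw [hk]; norm_num)
    have e := h1 0
    norm_num at e
    linarith
  · have hs : √2 ^ 2 = 2 := Real.sq_sqrt (by norm_num)
    have hk8 : k ^ 2 ≤ 8 := by
      have := sq_le_sq' (abs_le.1 hr).1 (abs_le.1 hr).2
      rw [hk, mul_pow]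
      linarith [div_pow (√2) 4 2]
    have hr1 : 1 - r ≠ 0 := by
      intro h
      have : r = 1 := by linarith
      rw [hk, this] at hk8
      norm_num at hk8
    -- The quadratic form `Q` is doubled at each step, so it vanishes on a solution of size
    -- `o(2 ^ (n / 2))`.
    set Q : ℕ → ℝ := fun n => α (n + 1) ^ 2 + 2 * α n ^ 2 - k * α n * α (n + 1) with hQ
    have hQn : ∀ n, Q n = 2 ^ n * Q 0 := by
      intro n
      induction n with
      | zero => simp
      | succ n ih =>
        have : Q (n + 1) = 2 * Q n := by
          simp only [hQ]; rw [hrec n]; ring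
        rw [this, ih, pow_succ]; ring
    have hle : ∀ n, |Q 0| ≤ 4 * (α (n + 1) ^ 2 / 2 ^ n + α n ^ 2 / 2 ^ n) := by
      intro n
      rw [← add_div, mul_div_assoc', le_div_iff₀ (by positivity), mul_comm]
      have h3 : (2 : ℝ) ^ n * |Q 0| = |Q n| := by
        rw [hQn n, abs_mul, abs_of_pos (by positivity : (0 : ℝ) < 2 ^ n)]
      have h4 : k ≤ 3 := by nlinarith
      have h5 : -3 ≤ k := by nlinarith
      rw [h3, abs_le]
      constructor
      · simp only [hQ]
        nlinarith [sq_nonneg (α (n + 1) - α n), sq_nonneg (α (n + 1) + α n)]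
      · simp only [hQ]
        nlinarith [sq_nonneg (α (n + 1) - α n), sq_nonneg (α (n + 1) + α n)]
    have hQ0 : Q 0 = 0 := by
      have h3 := ge_of_tendsto' (hsum.const_mul 4) hle
      rw [mul_zero] at h3
      exact abs_nonpos_iff.1 h3
    have hsq : ∀ n, (α (n + 1) - k / 2 * α n) ^ 2 + (2 - k ^ 2 / 4) * α n ^ 2 = 0 := by
      intro n
      have := hQn n
      rw [hQ0, mul_zero] at this
      rw [← this]; simp only [hQ]; ring
    have hα1 : ∀ n, α (n + 1) = k / 2 * α n := by
      intro n
      have h3 : 0 ≤ (2 - k ^ 2 / 4) * α n ^ 2 := mul_nonneg (by linarith) (sq_nonneg _)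
      have := pow_eq_zero_iff (two_ne_zero) |>.1
        (le_antisymm (by linarith [hsq n]) (sq_nonneg (α (n + 1) - k / 2 * α n)))
      linarith
    have hα0 : α 0 = 0 := by
      rcases hk8.lt_or_eq with hlt | heq
      · have h3 := hsq 0
        rw [hα1 0] at h3
        have : (2 - k ^ 2 / 4) * α 0 ^ 2 = 0 := by linarith
        rcases mul_eq_zero.1 this with h4 | h4
        · linarith
        · exact pow_eq_zero_iff (two_ne_zero) |>.1 h4
      · have h3 : ∀ n, α n ^ 2 / 2 ^ n = α 0 ^ 2 := by
          intro n
          induction n with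
          | zero => simp
          | succ n ih =>
            rw [← ih, hα1 n, mul_pow, div_pow, heq, pow_succ]; field_simp; ring
        have h4 := tendsto_nhds_unique (hα.congr h3) tendsto_const_nhds
        exact pow_eq_zero_iff (two_ne_zero) |>.1 h4.symm
    have hγ0 : γ 0 = 0 := by
      have e := h1 0
      rw [hα1 0, hα0] at e
      have : (1 - r) * γ 0 = 0 := by linarith
      exact (mul_eq_zero.1 this).resolve_left hr1
    rw [hα0, hγ0] at h0
    norm_num at h0

/-! ### The points of the spectrum -/

theorem summable_sq_re_sub (φ : ell2 PSL(2, ℤ)) (g h : PSL(2, ℤ)) :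
    Summable fun x => ((φ (g * x)).re - (φ (h * x)).re) ^ 2 := by
  have hs : ∀ g : PSL(2, ℤ), Summable fun x => ‖φ (g * x)‖ ^ 2 := fun g =>
    (hasSum_norm_sq φ).summable.comp_injective (mul_right_injective g)
  have hre : ∀ z : ℂ, z.re ^ 2 ≤ ‖z‖ ^ 2 := fun z =>
    sq_le_sq' (abs_le.1 (Complex.abs_re_le_norm z)).1 (abs_le.1 (Complex.abs_re_le_norm z)).2
  refine Summable.of_nonneg_of_le (fun x => sq_nonneg _) (fun x => ?_)
    (((hs g).mul_left 2).add ((hs h).mul_left 2))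
  nlinarith [hre (φ (g * x)), hre (φ (h * x)),
    sq_nonneg ((φ (g * x)).re + (φ (h * x)).re)]

open Classical in
theorem re_eq_of_sub_apply_eq_single {r : ℝ} {φ : ell2 PSL(2, ℤ)} {g : PSL(2, ℤ)}
    (hφ : (laplacian - (r : ℂ) • 1) φ = lp.single 2 g (1 : ℂ)) (y : PSL(2, ℤ)) :
    (1 - r) * (φ y).re - 1 / 2 * (φ (y * a)).re - 1 / 4 * (φ (y * b)).re -
      1 / 4 * (φ (y * b⁻¹)).re = if y = g then 1 else 0 := by
  have e1 : φ y - 1 / 2 * φ (y * a) - 1 / 4 * φ (y * b) - 1 / 4 * φ (y * b⁻¹) - r * φ y =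
      if y = g then 1 else 0 := by
    have e2 : (laplacian φ : PSL(2, ℤ) → ℂ) y - (r : ℂ) * φ y =
        (lp.single 2 g (1 : ℂ) : ell2 PSL(2, ℤ)) y := by rw [← hφ]; rfl
    rw [laplacian_apply, lp.single_apply, Pi.single_apply] at e2
    exact e2
  have e3 := congrArg Complex.re e1
  have e4 : (if y = g then (1 : ℂ) else 0).re = if y = g then 1 else 0 := by
    split_ifs <;> simp
  rw [e4] at e3
  rw [← e3]
  simp
  ring

/-- The point mass at `b` is not in the range of `laplacian - r`. The antisymmetrization
`φ (b x) - φ (b⁻¹ x)` of a preimage `φ` has sum zero over the triangle `⟨b⟩`, which closes the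
recurrence for its sums over the levels. -/
theorem not_isUnit_laplacian_sub {r : ℝ}
    (hr : r = 3 / 4 ∨ r = 7 / 4 ∨ |(r - 7 / 8) ^ 2 - 25 / 64| ≤ √2 / 4) :
    ¬ IsUnit (laplacian - (r : ℂ) • 1) := by
  classical
  intro hu
  obtain ⟨φ, hφ1⟩ := (ContinuousLinearMap.isUnit_iff_bijective.1 hu).2 (lp.single 2 b (1 : ℂ))
  have hφ2 := re_eq_of_sub_apply_eq_single hφ1
  set ψ : PSL(2, ℤ) → ℝ := fun x => (φ (b * x)).re - (φ (b⁻¹ * x)).re with hψ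
  have hsum : Summable fun x => ψ x ^ 2 := summable_sq_re_sub φ b b⁻¹
  have hbx : ∀ x, b⁻¹ * x = b ↔ x = b⁻¹ := fun x => by rw [inv_mul_eq_iff_eq_mul, b_mul_b]
  have hψ1 : ∀ x, (1 - r) * ψ x - 1 / 2 * ψ (x * a) - 1 / 4 * ψ (x * b) - 1 / 4 * ψ (x * b⁻¹) =
      (if x = 1 then 1 else 0) - if x = b⁻¹ then 1 else 0 := by
    intro x
    have e1 := hφ2 (b * x)
    have e2 := hφ2 (b⁻¹ * x)
    simp only [mul_assoc, hbx, mul_eq_left] at e1 e2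
    simp only [hψ]
    linarith
  have hψ0 : ∀ x, x ≠ 1 → x ≠ b⁻¹ →
      (1 - r) * ψ x - 1 / 2 * ψ (x * a) - 1 / 4 * ψ (x * b) - 1 / 4 * ψ (x * b⁻¹) = 0 := by
    intro x h1 h2
    rw [hψ1, if_neg h1, if_neg h2, sub_zero]
  have hba : ∀ x : PSL(2, ℤ), x * a = b⁻¹ ↔ x = b⁻¹ * a := fun x => by
    rw [← eq_mul_inv_iff_mul_eq, inv_a]
  have ha1 : ∀ x : PSL(2, ℤ), x * a = 1 ↔ x = a := fun x => by
    rw [← eq_mul_inv_iff_mul_eq, inv_a, one_mul]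
  have haa : ∀ x : PSL(2, ℤ), x * a * a = x := fun x => by rw [mul_assoc, a_mul_a, mul_one]
  refine false_of_recurrence (r := r) (α := fun n => ∑ x ∈ level n, ψ x)
    (γ := fun n => ∑ x ∈ level n, ψ (x * a)) ?_ (fun n => ?_) (fun n => ?_)
    (tendsto_sum_level hsum) hr
  · have e1 := hψ1 1
    have hb1 : (1 : PSL(2, ℤ)) ≠ b⁻¹ := fun h => inv_b_notMem_level 0 (by simp [level, ← h])
    rw [if_pos rfl, if_neg hb1] at e1
    have e2 : ψ b + ψ b⁻¹ = -ψ 1 := by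
      simp only [hψ, b_mul_b, inv_b_mul_inv_b, mul_inv_cancel, inv_mul_cancel, mul_one]
      ring
    simp only [level, Finset.sum_singleton, one_mul] at e1 ⊢
    linarith
  · simp only [sum_level_succ, Finset.mul_sum, ← Finset.sum_sub_distrib]
    refine Finset.sum_eq_zero fun x hx => ?_
    have e := hψ0 (x * a) (fun h => a_notMem_level n ((ha1 x).1 h ▸ hx))
      (fun h => inv_b_mul_a_notMem_level n ((hba x).1 h ▸ hx))
    rw [haa] at e
    simp only [← mul_assoc]
    linarith
  · -- The equations at the vertices `xab` and `xab⁻¹` of the triangle of `xa` are added.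
    have e : ∑ x ∈ level (n + 1),
        ((1 - r) * ψ x - 1 / 2 * ψ (x * a) - 1 / 4 * ψ (x * b) - 1 / 4 * ψ (x * b⁻¹)) = 0 := by
      refine Finset.sum_eq_zero fun x hx => hψ0 x (fun h => ?_) (fun h => ?_)
      · exact one_notMem_level_succ n (h ▸ hx)
      · exact inv_b_notMem_level (n + 1) (h ▸ hx)
    rw [← e]
    simp only [sum_level_succ, Finset.mul_sum, ← Finset.sum_sub_distrib]
    refine Finset.sum_congr rfl fun x _ => ?_
    have e1 : x * (a * b) * b = x * (a * b⁻¹) := by rw [mul_assoc, mul_assoc, b_mul_b]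
    have e2 : x * (a * b) * b⁻¹ = x * a := by rw [mul_assoc, mul_inv_cancel_right]
    have e3 : x * (a * b⁻¹) * b = x * a := by rw [mul_assoc, inv_mul_cancel_right]
    have e4 : x * (a * b⁻¹) * b⁻¹ = x * (a * b) := by rw [mul_assoc, mul_assoc, inv_b_mul_inv_b]
    rw [e1, e2, e3, e4]
    ring

theorem mem_spectrum_laplacian_iff (r : ℝ) : (r : ℂ) ∈ spectrum ℂ laplacian ↔
    r = 3 / 4 ∨ r = 7 / 4 ∨ |(r - 7 / 8) ^ 2 - 25 / 64| ≤ √2 / 4 := by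
  rw [spectrum.mem_iff, Algebra.algebraMap_eq_smul_one, ← IsUnit.neg_iff, neg_sub]
  constructor
  · contrapose!
    rintro ⟨h1, h2, h3⟩
    exact isUnit_laplacian_sub h1 h2 h3
  · exact not_isUnit_laplacian_sub

/-! ### The bands -/

theorem sqrt_two_bounds : 1.414213 < √2 ∧ √2 < 1.414214 :=
  ⟨Real.lt_sqrt_of_sq_lt (by norm_num), (Real.sqrt_lt' (by norm_num)).2 (by norm_num)⟩

theorem lambda0_mem : lambda0 ∈ Set.Ico (0.01234 : ℝ) 0.01235 := by
  obtain ⟨h1, h2⟩ := sqrt_two_bounds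
  have h3 : (1.7253 : ℝ) < √(25 / 16 + √2) := Real.lt_sqrt_of_sq_lt (by norm_num; linarith)
  have h4 : √(25 / 16 + √2) < 1.72532 :=
    (Real.sqrt_lt' (by norm_num)).2 (by norm_num; linarith)
  constructor <;> rw [lambda0] <;> norm_num <;> linarith

theorem lambda1_mem : lambda1 ∈ Set.Ico (1.0675 : ℝ) 1.0676 := by
  obtain ⟨h1, h2⟩ := sqrt_two_bounds
  have h3 : (0.385 : ℝ) < √(25 / 16 - √2) := Real.lt_sqrt_of_sq_lt (by norm_num; linarith)
  have h4 : √(25 / 16 - √2) < 0.3852 :=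
    (Real.sqrt_lt' (by norm_num)).2 (by norm_num; linarith)
  constructor <;> rw [lambda1] <;> norm_num <;> linarith

theorem abs_le_iff_mem_bands (r : ℝ) : |(r - 7 / 8) ^ 2 - 25 / 64| ≤ √2 / 4 ↔
    r ∈ Set.Icc lambda0 (7 / 4 - lambda1) ∨ r ∈ Set.Icc lambda1 (7 / 4 - lambda0) := by
  obtain ⟨h1, h2⟩ := sqrt_two_bounds
  have hs := Real.sq_sqrt (by linarith : 0 ≤ 25 / 16 + √2)
  have ht := Real.sq_sqrt (by linarith : 0 ≤ 25 / 16 - √2)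
  have hs0 := Real.sqrt_nonneg (25 / 16 + √2)
  have ht0 := Real.sqrt_nonneg (25 / 16 - √2)
  rw [Set.mem_Icc, Set.mem_Icc, lambda0, lambda1, abs_le]
  generalize √(25 / 16 + √2) = s at *
  generalize √(25 / 16 - √2) = t at *
  have e : (-(√2 / 4) ≤ (r - 7 / 8) ^ 2 - 25 / 64 ∧ (r - 7 / 8) ^ 2 - 25 / 64 ≤ √2 / 4) ↔
      (t / 2) ^ 2 ≤ (r - 7 / 8) ^ 2 ∧ (r - 7 / 8) ^ 2 ≤ (s / 2) ^ 2 := by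
    rw [div_pow, div_pow, hs, ht]
    constructor <;> rintro ⟨h3, h4⟩ <;> constructor <;> linarith
  rw [e, sq_le_sq, sq_le_sq, abs_of_nonneg (by linarith : 0 ≤ t / 2),
    abs_of_nonneg (by linarith : 0 ≤ s / 2), abs_le, le_abs]
  constructor
  · rintro ⟨h3 | h3, h4, h5⟩
    · right; constructor <;> linarith
    · left; constructor <;> linarith
  · rintro (⟨h3, h4⟩ | ⟨h3, h4⟩)
    · exact ⟨Or.inr (by linarith), by linarith, by linarith⟩
    · exact ⟨Or.inl (by linarith), by linarith, by linarith⟩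

end ModularCayley

end

theorem mainTheorem2 :
    spectrum ℂ ModularCayley.laplacian =
      (fun r : ℝ => (r : ℂ)) ''
        (Set.Icc ModularCayley.lambda0 (7 / 4 - ModularCayley.lambda1) ∪ {3 / 4} ∪
          Set.Icc ModularCayley.lambda1 (7 / 4 - ModularCayley.lambda0) ∪ {7 / 4}) ∧
    [Set.Icc ModularCayley.lambda0 (7 / 4 - ModularCayley.lambda1), {3 / 4},
      Set.Icc ModularCayley.lambda1 (7 / 4 - ModularCayley.lambda0), {7 / 4}].Pairwise
        Disjoint ∧
    ModularCayley.lambda0 ∈ Set.Ico (0.01234 : ℝ) 0.01235 ∧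
    ModularCayley.lambda1 ∈ Set.Ico (1.0675 : ℝ) 1.0676 := by
  have hr := ModularCayley.mem_spectrum_laplacian_iff
  have hb := ModularCayley.abs_le_iff_mem_bands
  refine ⟨?_, ?_, ModularCayley.lambda0_mem, ModularCayley.lambda1_mem⟩
  · ext z
    constructor
    · intro hz
      have hz' := ModularCayley.isSelfAdjoint_laplacian.mem_spectrum_eq_re hz
      refine ⟨z.re, ?_, hz'.symm⟩
      rw [hz', hr, hb] at hz
      simp only [Set.mem_union, Set.mem_singleton_iff]
      tauto
    · rintro ⟨r, h, rfl⟩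
      simp only [Set.mem_union, Set.mem_singleton_iff] at h
      rw [hr, hb]
      tauto
  · obtain ⟨h1, h2⟩ := ModularCayley.lambda0_mem
    obtain ⟨h3, h4⟩ := ModularCayley.lambda1_mem
    norm_num at h1 h2 h3 h4
    simp only [List.pairwise_cons, List.mem_cons, List.not_mem_nil, or_false, forall_eq_or_imp,
      forall_eq, Set.disjoint_singleton_right, Set.disjoint_singleton_left, Set.mem_Icc,
      Set.mem_singleton_iff, not_and, not_le, IsEmpty.forall_iff, implies_true, and_true,
      List.Pairwise.nil]
    refine ⟨⟨fun _ => by linarith, ?_, fun _ => by linarith⟩, ⟨fun h => by linarith, by norm_num⟩,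
      fun _ => by linarith⟩
    rw [Set.disjoint_left]
    rintro x ⟨-, hx⟩ ⟨hx', -⟩
    linarith
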